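/- Let $n\ge 1$, $0<s<\tfrac12$, and let $\Omega\subset\mathbb R^n$ be a nonempty Lebesgue measurable Lipschitz set with $\mathcal L^n(\Omega)<\infty$. Here $\Omega$ is a Lipschitz set if every $p\in\partial\Omega$ has a neighbourhood $U$ such that, in suitable orthonormal coordinates $(y',y_n)$ and for some Lipschitz function $g$, $$U\cap\{y_n>g(y')\}\subset U\cap\Omega\subset U\cap\{y_n\ge g(y')\}$$ (for open $\Omega$ this is the usual notion; if $\Omega$ is not open, it may contain any part of its boundary). Write $x=(x_1,x')$. Assume: (a) (decay condition in one direction) for both $\Omega_+=\Omega$ and $\Omega_-=\{(-x_1,x'):(x_1,x')\in\Omega\}$ there are a function $h:[0,\infty)\to[0,\infty)$ and a constant $C\ge 0$ with $\mathcal H^{n-1}(\Omega_\pm\cap\{x_1=R\})\le C\,h(R)$ for all $R>0$, and there are $a>0$ and a sequence $(R_k)$ in $[0,\infty)$ with $R_k\to\infty$, $h(R_k)\to 0$, and $h(R_k+\eta)\le h(R_k)$ for all $k$ and all $\eta\in[0,a)$ ($h$, $C$, $a$, $(R_k)$ may differ for $\Omega_+$ and $\Omega_-$); (b) for every $K>0$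 the set $\Omega\cap\{|x_1|<K\}$ is bounded. Then $$P^1_{n,s}(\Omega):=\inf\left\{\frac{[u]_{s,2,\Omega}^2}{\int_\Omega u^2}\,:\,u\in W^{s,2}_0(\Omega),\ u\ne 0\right\}=0,$$ where $$[u]_{s,2,\Omega}^2=\frac{C_{n,s}}2\int_\Omega\int_\Omega\frac{|u(x)-u(y)|^2}{|x-y|^{n+2s}}\,dx\,dy,\qquad C_{n,s}=\frac{s\,2^{2s}\,\Gamma\left(\frac{n+2s}2\right)}{\pi^{n/2}\,\Gamma(1-s)},$$ $W^{s,2}(\Omega)$ is the space of real-valued $u\in L^2(\Omega)$ with $[u]_{s,2,\Omega}<\infty$, normed by $\left(\|u\|_{L^2(\Omega)}^2+[u]_{s,2,\Omega}^2\right)^{1/2}$, and $W_0^{s,2}(\Omega)$ is the closure of $C_c^\infty(\Omega)$ in $W^{s,2}(\Omega)$, where $C_c^\infty(\Omega)$ consists of the smooth functions on $\mathbb R^n$ with compact support contained in $\Omega$. -/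

import Mathlib

open MeasureTheory Filter Topology
open scoped ENNReal NNReal ContDiff

noncomputable section

namespace RegionalPoincare

/-- The normalising constant
`C_{n,s} = s 2^{2s} Γ((n+2s)/2) / (π^{n/2} Γ(1-s))` of the fractional Laplacian. -/
def fracConst (n : ℕ) (s : ℝ) : ℝ :=
  s * (2 : ℝ) ^ (2 * s) * Real.Gamma (((n : ℝ) + 2 * s) / 2) /
    (Real.pi ^ ((n : ℝ) / 2) * Real.Gamma (1 - s))

/-- The double integral `∫_Ω ∫_Ω |u(x) - u(y)|² / |x - y|^{n+2s} dx dy`, as an element of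
`[0, ∞]`. -/
def gagliardoIntegral {n : ℕ} (s : ℝ) (Ω : Set (EuclideanSpace ℝ (Fin n)))
    (u : EuclideanSpace ℝ (Fin n) → ℝ) : ℝ≥0∞ :=
  ∫⁻ x in Ω, ∫⁻ y in Ω,
    ENNReal.ofReal (|u x - u y| ^ 2 / ‖x - y‖ ^ ((n : ℝ) + 2 * s))

/-- The squared Gagliardo seminorm `[u]²_{s,2,Ω}`. -/
def gagliardoSq {n : ℕ} (s : ℝ) (Ω : Set (EuclideanSpace ℝ (Fin n)))
    (u : EuclideanSpace ℝ (Fin n) → ℝ) : ℝ≥0∞ :=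
  ENNReal.ofReal (fracConst n s / 2) * gagliardoIntegral s Ω u

/-- The squared norm `∫_Ω u²`. -/
def l2Sq {n : ℕ} (Ω : Set (EuclideanSpace ℝ (Fin n)))
    (u : EuclideanSpace ℝ (Fin n) → ℝ) : ℝ≥0∞ :=
  ∫⁻ x in Ω, ENNReal.ofReal (u x ^ 2)

/-- The norm `‖u‖_{s,2,Ω} = (‖u‖²_{L²(Ω)} + [u]²_{s,2,Ω})^{1/2}`. -/
def sobolevNorm {n : ℕ} (s : ℝ) (Ω : Set (EuclideanSpace ℝ (Fin n)))
    (u : EuclideanSpace ℝ (Fin n) → ℝ) : ℝ≥0∞ :=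
  (l2Sq Ω u + gagliardoSq s Ω u) ^ (1 / 2 : ℝ)

/-- `u ∈ W^{s,2}(Ω)`. Only the values of `u` on `Ω` matter. -/
def MemW {n : ℕ} (s : ℝ) (Ω : Set (EuclideanSpace ℝ (Fin n)))
    (u : EuclideanSpace ℝ (Fin n) → ℝ) : Prop :=
  MemLp u 2 (volume.restrict Ω) ∧ gagliardoIntegral s Ω u < ⊤

/-- `φ ∈ C_c^∞(Ω)`. -/
def IsTestFunction {n : ℕ} (Ω : Set (EuclideanSpace ℝ (Fin n)))
    (φ : EuclideanSpace ℝ (Fin n) → ℝ) : Prop :=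
  ContDiff ℝ ∞ φ ∧ HasCompactSupport φ ∧ tsupport φ ⊆ Ω

/-- `u ∈ W_0^{s,2}(Ω)`: the closure of `C_c^∞(Ω)` in `W^{s,2}(Ω)` for `‖·‖_{s,2,Ω}`. -/
def MemWZero {n : ℕ} (s : ℝ) (Ω : Set (EuclideanSpace ℝ (Fin n)))
    (u : EuclideanSpace ℝ (Fin n) → ℝ) : Prop :=
  MemW s Ω u ∧ ∀ ε : ℝ≥0∞, 0 < ε →
    ∃ φ : EuclideanSpace ℝ (Fin n) → ℝ, IsTestFunction Ω φ ∧ sobolevNorm s Ω (u - φ) < ε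

/-- The best constant `P¹_{n,s}(Ω)` of the regional fractional Poincaré inequality: the infimum
of `[u]²_{s,2,Ω} / ∫_Ω u²` over the nonzero elements `u` of `W_0^{s,2}(Ω)`, taken in `[0, ∞]`
(so that the infimum of the empty set is `∞`, not `0`). -/
def regionalPoincareConst {n : ℕ} (s : ℝ) (Ω : Set (EuclideanSpace ℝ (Fin n))) : ℝ≥0∞ :=
  ⨅ (u : EuclideanSpace ℝ (Fin n) → ℝ) (_ : MemWZero s Ω u)
    (_ : ¬ u =ᵐ[volume.restrict Ω] 0), gagliardoSq s Ω u / l2Sq Ω u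

/-- `Ω` is a Lipschitz set: near each boundary point, in orthonormal coordinates whose last axis
is the unit vector `e`, `Ω` is the region above the graph of a Lipschitz function of the remaining
coordinates, up to points of the graph itself. The point `x - ⟪e, x⟫ e` is the orthogonal
projection of `x` to the hyperplane `e^⊥`. For open `Ω` (no point of the graph near the boundary
point can then belong to `Ω`) this is the usual notion of an open set with locally Lipschitz
boundary; a set that is not open may contain any part of its boundary. -/
def IsLipschitzSet {n : ℕ} (Ω : Set (EuclideanSpace ℝ (Fin n))) : Prop :=
  ∀ p ∈ frontier Ω, ∃ e : EuclideanSpace ℝ (Fin n), ‖e‖ = 1 ∧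
    ∃ (g : EuclideanSpace ℝ (Fin n) → ℝ) (K : ℝ≥0), LipschitzWith K g ∧
      ∃ U ∈ 𝓝 p, ∀ x ∈ U,
        (g (x - inner ℝ e x • e) < inner ℝ e x → x ∈ Ω) ∧
        (x ∈ Ω → g (x - inner ℝ e x • e) ≤ inner ℝ e x)

/-- The reflection `(x₁, x') ↦ (-x₁, x')`. -/
def flipFirst {n : ℕ} [NeZero n] (x : EuclideanSpace ℝ (Fin n)) : EuclideanSpace ℝ (Fin n) :=
  WithLp.toLp 2 (Function.update x.ofLp 0 (-x 0))

/-- The decay of the cross-sections of `Ω` as `x₁ → +∞`. The coordinate `x₁` is `x 0`, and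
`μHE[n - 1]` is the `(n-1)`-dimensional Hausdorff measure (counting measure for `n = 1`). -/
def DecaysToTheRight {n : ℕ} [NeZero n] (Ω : Set (EuclideanSpace ℝ (Fin n))) : Prop :=
  ∃ h : ℝ≥0 → ℝ≥0,
    (∃ C : ℝ≥0, ∀ R : ℝ≥0, 0 < R →
      μHE[n - 1] (Ω ∩ {x | x 0 = (R : ℝ)}) ≤ ((C * h R : ℝ≥0) : ℝ≥0∞)) ∧
    ∃ a : ℝ≥0, 0 < a ∧ ∃ R : ℕ → ℝ≥0,
      Tendsto R atTop atTop ∧ Tendsto (fun k => h (R k)) atTop (𝓝 0) ∧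
      ∀ k, ∀ η : ℝ≥0, η < a → h (R k + η) ≤ h (R k)

/-- The decay condition in one direction: both `Ω` and its reflection in `{x₁ = 0}` decay as
`x₁ → +∞`. -/
def DecayInOneDirection {n : ℕ} [NeZero n] (Ω : Set (EuclideanSpace ℝ (Fin n))) : Prop :=
  DecaysToTheRight Ω ∧ DecaysToTheRight (flipFirst '' Ω)

end RegionalPoincare

end

/-! For `s < 1/2` the constant `1` on `Ω` is a limit, in energy, of test functions: cutting it off
near the boundary and at infinity costs arbitrarily little. At scale `δ` the boundary cutoff has
Lipschitz constant of order `1/δ`. Interpolating between this and boundedness with an exponent `σ`,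
`s < σ < 1/2`, bounds its energy by `δ^(-2σ)` times the measure of a bounded tube around the
boundary. The tube has measure `O(δ)` (`IsLipschitzSet.exists_volume_tube_le`), which leaves
`δ^(1-2σ) → 0`. The cutoff at radius `R` has Lipschitz constant `1` and costs a multiple of the
measure of `Ω` outside the ball, which is small because `Ω` has finite measure.
`exists_isTestFunction_gagliardoIntegral_le` combines both costs;
`exists_isTestFunction_small_energy` chooses `R`, then `δ`. The `L²` norms stay bounded below
because every cutoff equals `1` on one fixed ball inside `Ω`. -/

namespace RegionalPoincare

/-! ### Energy bounds through an integrable kernel -/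

/-- The integrable kernel `min(1, |z|^{2σ}) / |z|^{n+2s}`. -/
noncomputable def truncKernel {n : ℕ} (s σ : ℝ) (z : EuclideanSpace ℝ (Fin n)) : ℝ :=
  min 1 (‖z‖ ^ (2 * σ)) / ‖z‖ ^ ((n : ℝ) + 2 * s)

theorem truncKernel_nonneg {n : ℕ} (s σ : ℝ) (z : EuclideanSpace ℝ (Fin n)) :
    0 ≤ truncKernel s σ z := by
  unfold truncKernel; positivity

theorem measurable_truncKernel {n : ℕ} (s σ : ℝ) :
    Measurable (truncKernel s σ : EuclideanSpace ℝ (Fin n) → ℝ) := by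
  unfold truncKernel; fun_prop

theorem truncKernel_neg {n : ℕ} (s σ : ℝ) (z : EuclideanSpace ℝ (Fin n)) :
    truncKernel s σ (-z) = truncKernel s σ z := by
  simp [truncKernel]

/-- In polar coordinates the density is `r^(2σ-2s-1)` near `0`, integrable because `σ > s`, and
`r^(-1-2s)` at infinity, integrable because `s > 0`. -/
theorem integrable_truncKernel {n : ℕ} [NeZero n] {s σ : ℝ} (hs : 0 < s) (hσ : s < σ) :
    Integrable (truncKernel s σ : EuclideanSpace ℝ (Fin n) → ℝ) := by
  have hn : (n - 1 : ℕ) = (n : ℝ) - 1 := by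
    rw [Nat.cast_sub NeZero.one_le, Nat.cast_one]
  refine (integrable_fun_norm_addHaar volume
    (f := fun r : ℝ => min 1 (r ^ (2 * σ)) / r ^ ((n : ℝ) + 2 * s))).2 ?_
  rw [finrank_euclideanSpace_fin, ← Set.Ioc_union_Ioi_eq_Ioi zero_le_one]
  refine IntegrableOn.union ?_ ?_
  · have h : IntegrableOn (fun r : ℝ => r ^ (2 * σ - 2 * s - 1)) (Set.Ioc 0 1) :=
      (intervalIntegrable_iff_integrableOn_Ioc_of_le zero_le_one).1
        (intervalIntegral.intervalIntegrable_rpow' (by linarith))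
    refine h.congr_fun (fun r hr => ?_) measurableSet_Ioc
    have h1 : r ^ (2 * σ) ≤ 1 := Real.rpow_le_one hr.1.le hr.2 (by linarith)
    simp only [smul_eq_mul, min_eq_right h1]
    rw [← Real.rpow_natCast, hn, ← Real.rpow_sub hr.1, ← Real.rpow_add hr.1]
    congr 1; ring
  · have h : IntegrableOn (fun r : ℝ => r ^ (-1 - 2 * s)) (Set.Ioi 1) :=
      integrableOn_Ioi_rpow_of_lt (by linarith) one_pos
    refine h.congr_fun (fun r hr => ?_) measurableSet_Ioi
    have hr : 1 < r := hr
    have h0 : 0 < r := by linarith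
    have h1 : 1 ≤ r ^ (2 * σ) := Real.one_le_rpow hr.le (by linarith)
    simp only [smul_eq_mul, min_eq_left h1, one_div]
    rw [← Real.rpow_natCast, hn, ← Real.rpow_neg h0.le, ← Real.rpow_add h0]
    congr 1; ring

/-- Interpolation between the bounds `1` and `L r`: the Lipschitz constant enters with the power
`2σ` instead of `2`, and this makes a steep cutoff cheap. -/
theorem sq_le_rpow_mul_min {a L r σ : ℝ} (hL : 1 ≤ L) (hr : 0 ≤ r) (hσ0 : 0 ≤ σ) (hσ1 : σ ≤ 1)
    (ha : |a| ≤ 1) (haL : |a| ≤ L * r) :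
    |a| ^ 2 ≤ L ^ (2 * σ) * min 1 (r ^ (2 * σ)) := by
  rcases le_total 1 r with h | h
  · rw [min_eq_left (Real.one_le_rpow h (by linarith)), mul_one]
    exact (pow_le_one₀ (abs_nonneg a) ha).trans (Real.one_le_rpow hL (by linarith))
  · rw [min_eq_right (Real.rpow_le_one hr h (by linarith)), ← Real.mul_rpow (by linarith) hr]
    refine le_trans ?_ (Real.rpow_le_rpow (abs_nonneg a) haL (by linarith))
    rw [← Real.rpow_natCast]
    rcases (abs_nonneg a).eq_or_lt with h0 | h0
    · rw [← h0, Real.zero_rpow (by norm_num)]; positivity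
    · exact Real.rpow_le_rpow_of_exponent_ge h0 ha (by push_cast; linarith)

/-- A function that is `L`-Lipschitz with oscillation at most `1` and constant off `N` has
Gagliardo quotients controlled by the kernel. -/
theorem gagliardo_quotient_le {n : ℕ} {s σ L : ℝ} (hσ0 : 0 ≤ σ) (hσ1 : σ ≤ 1) (hL : 1 ≤ L)
    {Ω N : Set (EuclideanSpace ℝ (Fin n))} {v : EuclideanSpace ℝ (Fin n) → ℝ} {c : ℝ}
    (hc : ∀ x ∈ Ω, x ∉ N → v x = c) (h1 : ∀ x y, |v x - v y| ≤ 1)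
    (h2 : ∀ x y, |v x - v y| ≤ L * ‖x - y‖) {x y : EuclideanSpace ℝ (Fin n)}
    (hx : x ∈ Ω) (hy : y ∈ Ω) :
    |v x - v y| ^ 2 / ‖x - y‖ ^ ((n : ℝ) + 2 * s) ≤
      (N.indicator (fun _ => L ^ (2 * σ)) x + N.indicator (fun _ => L ^ (2 * σ)) y) *
        truncKernel s σ (x - y) := by
  have hL0 : 0 ≤ L ^ (2 * σ) := by positivity
  have hi : ∀ z, 0 ≤ N.indicator (fun _ => L ^ (2 * σ)) z := fun z =>
    Set.indicator_nonneg (fun _ _ => hL0) z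
  by_cases hN : x ∈ N ∨ y ∈ N
  · have h3 : L ^ (2 * σ) ≤
        N.indicator (fun _ => L ^ (2 * σ)) x + N.indicator (fun _ => L ^ (2 * σ)) y := by
      rcases hN with h | h
      · have := hi y; rw [Set.indicator_of_mem h]; linarith
      · have := hi x; rw [Set.indicator_of_mem h (fun _ => L ^ (2 * σ))]; linarith
    refine le_trans ?_ (mul_le_mul_of_nonneg_right h3 (truncKernel_nonneg s σ _))
    rw [truncKernel, ← mul_div_assoc]
    gcongr
    exact sq_le_rpow_mul_min hL (norm_nonneg _) hσ0 hσ1 (h1 x y) (h2 x y)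
  · push Not at hN
    rw [hc x hx hN.1, hc y hy hN.2]
    simp only [sub_self, abs_zero, ne_eq, OfNat.ofNat_ne_zero, not_false_eq_true, zero_pow,
      zero_div]
    exact mul_nonneg (add_nonneg (hi x) (hi y)) (truncKernel_nonneg s σ _)

/-- Tonelli and translation invariance: integrating out one variable leaves the total mass of the
kernel. The kernel is even, so both weights contribute equally, hence the factor `2`. -/
theorem gagliardoIntegral_le_of_quotient_le {n : ℕ} {s σ : ℝ}
    {Ω : Set (EuclideanSpace ℝ (Fin n))} (hΩ : NullMeasurableSet Ω)
    {u w : EuclideanSpace ℝ (Fin n) → ℝ} (hw : Measurable w) (hw0 : ∀ x, 0 ≤ w x)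
    (h : ∀ x ∈ Ω, ∀ y ∈ Ω, |u x - u y| ^ 2 / ‖x - y‖ ^ ((n : ℝ) + 2 * s) ≤
      (w x + w y) * truncKernel s σ (x - y)) :
    gagliardoIntegral s Ω u ≤
      2 * (∫⁻ z : EuclideanSpace ℝ (Fin n), ENNReal.ofReal (truncKernel s σ z)) *
        ∫⁻ x in Ω, ENNReal.ofReal (w x) := by
  set k : EuclideanSpace ℝ (Fin n) → ℝ≥0∞ := fun z => ENNReal.ofReal (truncKernel s σ z)
  set W : EuclideanSpace ℝ (Fin n) → ℝ≥0∞ := fun z => ENNReal.ofReal (w z)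
  have hk : Measurable k := (measurable_truncKernel s σ).ennreal_ofReal
  have hW : Measurable W := hw.ennreal_ofReal
  have hone : ∀ x, ∫⁻ y in Ω, W x * k (x - y) ≤ W x * ∫⁻ z, k z := fun x => by
    rw [lintegral_const_mul _ (by fun_prop)]
    refine mul_le_mul' le_rfl ((setLIntegral_le_lintegral _ _).trans ?_)
    rw [lintegral_sub_left_eq_self]
  have hx : ∫⁻ x in Ω, ∫⁻ y in Ω, W x * k (x - y) ≤ (∫⁻ z, k z) * ∫⁻ x in Ω, W x := by
    rw [mul_comm, ← lintegral_mul_const _ hW]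
    exact lintegral_mono hone
  have hy : ∫⁻ x in Ω, ∫⁻ y in Ω, W y * k (x - y) ≤ (∫⁻ z, k z) * ∫⁻ x in Ω, W x := by
    rw [lintegral_lintegral_swap (by fun_prop)]
    refine le_trans (le_of_eq ?_) hx
    refine lintegral_congr fun x => lintegral_congr fun y => ?_
    simp only [k]
    rw [← truncKernel_neg, neg_sub]
  calc gagliardoIntegral s Ω u
      ≤ ∫⁻ x in Ω, ∫⁻ y in Ω, (W x * k (x - y) + W y * k (x - y)) := by
        refine lintegral_mono_ae ?_
        filter_upwards [ae_restrict_mem₀ hΩ] with x hx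
        refine lintegral_mono_ae ?_
        filter_upwards [ae_restrict_mem₀ hΩ] with y hy
        refine (ENNReal.ofReal_le_ofReal (h x hx y hy)).trans (le_of_eq ?_)
        rw [ENNReal.ofReal_mul (add_nonneg (hw0 x) (hw0 y)),
          ENNReal.ofReal_add (hw0 x) (hw0 y), add_mul]
    _ = (∫⁻ x in Ω, ∫⁻ y in Ω, W x * k (x - y)) + ∫⁻ x in Ω, ∫⁻ y in Ω, W y * k (x - y) := by
        rw [← lintegral_add_left (by fun_prop)]
        refine lintegral_congr fun x => ?_
        rw [lintegral_add_left (by fun_prop)]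
    _ ≤ 2 * (∫⁻ z, k z) * ∫⁻ x in Ω, W x := by
        rw [mul_assoc, two_mul]; exact add_le_add hx hy

end RegionalPoincare

/-! ### Smoothing of Lipschitz cutoffs -/

/-- Mollification of a Lipschitz function with values in `[0, 1]`. -/
theorem LipschitzWith.exists_contDiff_mollification {E : Type*} [NormedAddCommGroup E]
    [InnerProductSpace ℝ E] [FiniteDimensional ℝ E] {f : E → ℝ} {K : ℝ≥0}
    (hf : LipschitzWith K f) (h0 : ∀ x, 0 ≤ f x) (h1 : ∀ x, f x ≤ 1) {r : ℝ} (hr : 0 < r) :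
    ∃ g : E → ℝ, ContDiff ℝ ∞ g ∧ (∀ x, 0 ≤ g x) ∧ (∀ x, g x ≤ 1) ∧ LipschitzWith K g ∧
      ∀ x c, (∀ y ∈ Metric.ball x r, f y = c) → g x = c := by
  borelize E
  let μ : Measure E := volume
  -- The outer radius is `r`, so the average at `x` only sees `f` on `Metric.ball x r`.
  let φ : ContDiffBump (0 : E) := ⟨r / 2, r, by linarith, by linarith⟩
  let ρ : E → ℝ := φ.normed μ
  have hρ0 : ∀ t, 0 ≤ ρ t := fun t => φ.nonneg_normed t
  have hρi : Integrable ρ μ := φ.integrable_normed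
  have hρ1 : ∫ t, ρ t ∂μ = 1 := φ.integral_normed
  let g : E → ℝ := convolution ρ f (ContinuousLinearMap.lsmul ℝ ℝ) μ
  have hg : ∀ x, g x = ∫ t, ρ t * f (x - t) ∂μ := fun x => rfl
  have hint : ∀ x, Integrable (fun t => ρ t * f (x - t)) μ := fun x =>
    hρi.mul_bdd (c := 1) (hf.continuous.comp (by fun_prop)).aestronglyMeasurable
      (Eventually.of_forall fun t => by
        rw [Real.norm_eq_abs, abs_of_nonneg (h0 _)]; exact h1 _)
  refine ⟨g, ?_, fun x => ?_, fun x => ?_, ?_, fun x c hc => ?_⟩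
  · exact φ.hasCompactSupport_normed.contDiff_convolution_left _ φ.contDiff_normed
      hf.continuous.locallyIntegrable
  · rw [hg]; exact integral_nonneg fun t => mul_nonneg (hρ0 t) (h0 _)
  · rw [hg, ← hρ1]
    exact integral_mono (hint x) hρi fun t => mul_le_of_le_one_right (hρ0 t) (h1 _)
  · refine LipschitzWith.of_dist_le_mul fun x y => ?_
    rw [Real.dist_eq, hg, hg, ← integral_sub (hint x) (hint y)]
    calc |∫ t, (ρ t * f (x - t) - ρ t * f (y - t)) ∂μ|
        ≤ ∫ t, |ρ t * f (x - t) - ρ t * f (y - t)| ∂μ := abs_integral_le_integral_abs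
      _ ≤ ∫ t, ρ t * (K * dist x y) ∂μ := by
          refine integral_mono ((hint x).sub (hint y)).abs (hρi.mul_const _) fun t => ?_
          change |ρ t * f (x - t) - ρ t * f (y - t)| ≤ _
          rw [← mul_sub, abs_mul, abs_of_nonneg (hρ0 t), ← Real.dist_eq]
          refine mul_le_mul_of_nonneg_left ?_ (hρ0 t)
          simpa using hf.dist_le_mul (x - t) (y - t)
      _ = K * dist x y := by rw [integral_mul_const, hρ1, one_mul]
  · have hx : f x = c := hc x (Metric.mem_ball_self hr)
    exact (φ.normed_convolution_eq_right fun y hy => (hc y hy).trans hx.symm).trans hx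

namespace RegionalPoincare

/-! ### Lipschitz graphs and tubes around the boundary -/

section Strip

variable {E : Type*} [NormedAddCommGroup E] [InnerProductSpace ℝ E]

/-- The signed height, in the direction `e`, over the graph of `g`. -/
noncomputable def graphHeight (e : E) (g : E → ℝ) (x : E) : ℝ :=
  inner ℝ e x - g (x - inner ℝ e x • e)

theorem graphHeight_add_smul {e : E} (he : ‖e‖ = 1) (g : E → ℝ) (x : E) (l : ℝ) :
    graphHeight e g (x + l • e) = graphHeight e g x + l := by
  have h : inner ℝ e (x + l • e) = inner ℝ e x + l := by
    rw [inner_add_right, inner_smul_right, real_inner_self_eq_norm_sq, he]; ring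
  have h2 : x + l • e - (inner ℝ e x + l) • e = x - inner ℝ e x • e := by
    rw [add_smul]; abel
  unfold graphHeight
  rw [h, h2]; ring

theorem abs_graphHeight_sub_le {e : E} (he : ‖e‖ = 1) {g : E → ℝ} {K : ℝ≥0}
    (hg : LipschitzWith K g) (x y : E) :
    |graphHeight e g x - graphHeight e g y| ≤ (1 + 2 * K) * dist x y := by
  have h1 : |inner ℝ e x - inner ℝ e y| ≤ dist x y := by
    rw [← inner_sub_right, dist_eq_norm]
    simpa [he] using abs_real_inner_le_norm e (x - y)
  have h2 : dist (x - inner ℝ e x • e) (y - inner ℝ e y • e) ≤ 2 * dist x y := by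
    refine (dist_sub_sub_le _ _ _ _).trans ?_
    rw [dist_eq_norm (inner ℝ e x • e), ← sub_smul, norm_smul, he, mul_one, Real.norm_eq_abs]
    linarith
  have h3 := hg.dist_le_mul (x - inner ℝ e x • e) (y - inner ℝ e y • e)
  rw [Real.dist_eq] at h3
  have h4 := mul_le_mul_of_nonneg_left h2 K.2
  have h5 := abs_sub (inner ℝ e x - inner ℝ e y)
    (g (x - inner ℝ e x • e) - g (y - inner ℝ e y • e))
  have h6 : graphHeight e g x - graphHeight e g y = (inner ℝ e x - inner ℝ e y) -
    (g (x - inner ℝ e x • e) - g (y - inner ℝ e y • e)) := by unfold graphHeight; ring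
  rw [h6]
  simp only [NNReal.val_eq_coe] at h4
  linarith

theorem continuous_graphHeight (e : E) {g : E → ℝ} {K : ℝ≥0}
    (hg : LipschitzWith K g) : Continuous (graphHeight e g) := by
  have := hg.continuous
  unfold graphHeight
  fun_prop

/-- The part of a ball at height at most `t` over a graph has measure `O(t)`: about `1 / t` of its
translates in the direction `e` are disjoint and lie in a fixed ball. -/
theorem volume_strip_le [FiniteDimensional ℝ E] [MeasurableSpace E] [BorelSpace E] {e : E}
    (he : ‖e‖ = 1) {g : E → ℝ} {K : ℝ≥0} (hg : LipschitzWith K g) (p : E) (r : ℝ) {t : ℝ}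
    (ht0 : 0 < t) (ht1 : t ≤ 1) :
    volume (Metric.ball p r ∩ {x | |graphHeight e g x| ≤ t}) ≤
      ENNReal.ofReal t * volume (Metric.ball p (r + 6)) := by
  set S := Metric.ball p r ∩ {x | |graphHeight e g x| ≤ t}
  have hS : MeasurableSet S := measurableSet_ball.inter
    (isClosed_le (continuous_graphHeight e hg).abs continuous_const).measurableSet
  let m := ⌈1 / t⌉₊
  have hm1 : 1 / t ≤ m := Nat.le_ceil _
  have hm2 : (m : ℝ) < 1 / t + 1 := Nat.ceil_lt_add_one (by positivity)
  have hm3 : t * m ≤ 2 := by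
    have := mul_le_mul_of_nonneg_left hm2.le ht0.le
    rw [mul_add, mul_one_div_cancel ht0.ne'] at this
    linarith
  -- Steps of `3t` exceed the strip's total height `2t`, so the translates are disjoint. The shifts
  -- stay below `3tm ≤ 6`, which explains the radius `r + 6`.
  let T : ℕ → Set E := fun j => (fun x => x + (-(3 * t * j)) • e) ⁻¹' S
  have hT : ∀ j, MeasurableSet (T j) := fun j => (measurable_add_const _) hS
  have hTv : ∀ j, volume (T j) = volume S := fun j => measure_preimage_add_right _ _ _
  have hdisj : Pairwise (Function.onFun Disjoint T) := by
    refine fun i j hij => Set.disjoint_left.2 fun x hi hj => hij ?_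
    have hi : |graphHeight e g (x + (-(3 * t * i)) • e)| ≤ t := hi.2
    have hj : |graphHeight e g (x + (-(3 * t * j)) • e)| ≤ t := hj.2
    rw [graphHeight_add_smul he, abs_le] at hi hj
    have h1 : t * (3 * ((i : ℝ) - j)) ≤ t * 2 := by linarith
    have h2 : t * (3 * ((j : ℝ) - i)) ≤ t * 2 := by linarith
    have h1 := le_of_mul_le_mul_left h1 ht0
    have h2 := le_of_mul_le_mul_left h2 ht0
    have h3 : (i : ℝ) < j + 1 := by linarith
    have h4 : (j : ℝ) < i + 1 := by linarith
    norm_cast at h3 h4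
    omega
  have hsub : ⋃ j ∈ Finset.range m, T j ⊆ Metric.ball p (r + 6) := by
    refine Set.iUnion₂_subset fun j hj x hx => ?_
    have h1 : dist (x + (-(3 * t * j)) • e) p < r := hx.1
    have hj : (j : ℝ) ≤ m := by exact_mod_cast (Finset.mem_range.1 hj).le
    have h2 : dist x (x + (-(3 * t * j)) • e) ≤ 6 := by
      rw [dist_self_add_right, norm_smul, he, mul_one, norm_neg, Real.norm_eq_abs,
        abs_of_nonneg (by positivity)]
      have := mul_le_mul_of_nonneg_left hj ht0.le
      linarith
    have := dist_triangle x (x + (-(3 * t * j)) • e) p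
    rw [Metric.mem_ball]; linarith
  have hcount : (m : ℝ≥0∞) * volume S ≤ volume (Metric.ball p (r + 6)) := by
    refine le_trans (le_of_eq ?_) (measure_mono hsub)
    rw [measure_biUnion_finset (fun i _ j _ hij => hdisj hij) fun j _ => hT j]
    simp [hTv]
  calc volume S = ENNReal.ofReal t * (ENNReal.ofReal (1 / t) * volume S) := by
        rw [← mul_assoc, ← ENNReal.ofReal_mul ht0.le, mul_one_div_cancel ht0.ne',
          ENNReal.ofReal_one, one_mul]
    _ ≤ ENNReal.ofReal t * ((m : ℝ≥0∞) * volume S) := by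
        gcongr
        rw [← ENNReal.ofReal_natCast]
        exact ENNReal.ofReal_le_ofReal hm1
    _ ≤ _ := by gcongr

end Strip

variable {n : ℕ}

/-- The boundary of a Lipschitz set lies locally on the graph. -/
theorem graphHeight_eq_zero_of_mem_frontier {Ω U : Set (EuclideanSpace ℝ (Fin n))}
    {e q : EuclideanSpace ℝ (Fin n)} {g : EuclideanSpace ℝ (Fin n) → ℝ} {K : ℝ≥0}
    (hg : LipschitzWith K g) (hU : U ∈ 𝓝 q)
    (h : ∀ x ∈ U, (g (x - inner ℝ e x • e) < inner ℝ e x → x ∈ Ω) ∧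
        (x ∈ Ω → g (x - inner ℝ e x • e) ≤ inner ℝ e x))
    (hq : q ∈ frontier Ω) : graphHeight e g q = 0 := by
  have hcont := (continuous_graphHeight e hg).continuousAt (x := q)
  refine le_antisymm ?_ ?_
  · by_contra! hlt
    have hev : ∀ᶠ x in 𝓝 q, x ∈ Ω := by
      filter_upwards [hcont.eventually (lt_mem_nhds hlt), hU] with x hx hxU
      exact (h x hxU).1 (sub_pos.1 hx)
    exact hq.2 (mem_interior_iff_mem_nhds.2 hev)
  · by_contra! hlt
    have hev : ∀ᶠ x in 𝓝 q, x ∉ Ω := by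
      filter_upwards [hcont.eventually (gt_mem_nhds hlt), hU] with x hx hxU hxΩ
      exact absurd (sub_nonneg.2 ((h x hxU).2 hxΩ)) (not_le.2 hx)
    exact (mem_closure_iff_frequently.1 hq.1) hev

/-- Tubes around bounded parts of the boundary of a Lipschitz set have measure `O(t)`. -/
theorem IsLipschitzSet.exists_volume_tube_le {Ω : Set (EuclideanSpace ℝ (Fin n))}
    (hΩ : IsLipschitzSet Ω) (hne : (frontier Ω).Nonempty) (R : ℝ) :
    ∃ C : ℝ≥0∞, C < ⊤ ∧ ∃ t₀ : ℝ, 0 < t₀ ∧ ∀ t, 0 < t → t ≤ t₀ →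
      volume (Metric.closedBall 0 R ∩ {x | Metric.infDist x (frontier Ω) ≤ t}) ≤
        ENNReal.ofReal t * C := by
  -- The extra `1` makes room for the boundary point nearest to a point of the ball, since `t ≤ 1`
  -- below.
  have hK : IsCompact (frontier Ω ∩ Metric.closedBall 0 (R + 1)) :=
    (isCompact_closedBall _ _).inter_left isClosed_frontier
  have key : ∃ C : ℝ≥0∞, C < ⊤ ∧ ∃ t₀ : ℝ, 0 < t₀ ∧ ∀ t, 0 < t → t ≤ t₀ →
      volume {x | ∃ q ∈ frontier Ω ∩ Metric.closedBall 0 (R + 1), dist x q ≤ t} ≤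
        ENNReal.ofReal t * C := by
    refine hK.induction_on (p := fun A => ∃ C : ℝ≥0∞, C < ⊤ ∧ ∃ t₀ : ℝ, 0 < t₀ ∧
      ∀ t, 0 < t → t ≤ t₀ → volume {x | ∃ q ∈ A, dist x q ≤ t} ≤ ENNReal.ofReal t * C)
      ⟨0, by simp, 1, one_pos, by simp⟩ ?_ ?_ ?_
    · rintro A B hAB ⟨C, hC, t₀, ht₀, h⟩
      refine ⟨C, hC, t₀, ht₀, fun t h0 h1 => (measure_mono ?_).trans (h t h0 h1)⟩
      rintro x ⟨q, hq, hxq⟩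
      exact ⟨q, hAB hq, hxq⟩
    · rintro A B ⟨C, hC, t₀, ht₀, h⟩ ⟨D, hD, t₁, ht₁, h'⟩
      refine ⟨C + D, ENNReal.add_lt_top.2 ⟨hC, hD⟩, min t₀ t₁, lt_min ht₀ ht₁,
        fun t h0 h1 => ?_⟩
      refine le_trans (measure_mono (t := {x | ∃ q ∈ A, dist x q ≤ t} ∪
        {x | ∃ q ∈ B, dist x q ≤ t}) ?_) ((measure_union_le _ _).trans ?_)
      · rintro x ⟨q, hq | hq, hxq⟩
        exacts [Or.inl ⟨q, hq, hxq⟩, Or.inr ⟨q, hq, hxq⟩]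
      · rw [mul_add]
        exact add_le_add (h t h0 (h1.trans (min_le_left _ _)))
          (h' t h0 (h1.trans (min_le_right _ _)))
    · rintro p ⟨hp, -⟩
      obtain ⟨e, he, g, K, hg, U, hU, hgr⟩ := hΩ p hp
      obtain ⟨r, hr, hrU⟩ := Metric.mem_nhds_iff.1 hU
      have hK0 : (0 : ℝ) < 1 + 2 * K := by positivity
      -- A point within `t` of the graph has height at most `(1 + 2K)t`; the threshold `1 / (1 +
      -- 2K)` keeps this at most `1`, as `volume_strip_le` requires.
      refine ⟨(frontier Ω ∩ Metric.closedBall 0 (R + 1)) ∩ Metric.ball p r,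
        inter_mem self_mem_nhdsWithin (mem_nhdsWithin_of_mem_nhds (Metric.ball_mem_nhds p hr)),
        ENNReal.ofReal (1 + 2 * K) * volume (Metric.ball p (r + 1 + 6)),
        ENNReal.mul_lt_top ENNReal.ofReal_lt_top measure_ball_lt_top, 1 / (1 + 2 * K),
        by positivity, fun t h0 h1 => ?_⟩
      have h2 : t * (1 + 2 * K) ≤ 1 := (le_div_iff₀ hK0).1 h1
      have ht1 : t ≤ 1 := h1.trans (by
        rw [div_le_one hK0]; have := K.coe_nonneg; linarith)
      rw [← mul_assoc, ← ENNReal.ofReal_mul h0.le]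
      refine le_trans (measure_mono ?_)
        (volume_strip_le he hg p (r + 1) (by positivity) h2)
      rintro x ⟨q, ⟨⟨hqf, -⟩, hqp⟩, hxq⟩
      have hq0 : graphHeight e g q = 0 :=
        graphHeight_eq_zero_of_mem_frontier hg
          (mem_of_superset (Metric.isOpen_ball.mem_nhds hqp) hrU) hgr hqf
      refine ⟨?_, ?_⟩
      · have := dist_triangle x q p
        rw [Metric.mem_ball] at hqp ⊢
        linarith
      · have := abs_graphHeight_sub_le he hg x q
        rw [hq0, sub_zero] at this
        refine this.trans ?_
        rw [mul_comm]
        exact mul_le_mul_of_nonneg_right hxq hK0.le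
  obtain ⟨C, hC, t₀, ht₀, h⟩ := key
  refine ⟨C, hC, min t₀ 1, lt_min ht₀ one_pos, fun t h0 h1 =>
    (measure_mono ?_).trans (h t h0 (h1.trans (min_le_left _ _)))⟩
  rintro x ⟨hxR, hx⟩
  obtain ⟨q, hq, hxq⟩ := isClosed_frontier.exists_infDist_eq_dist hne x
  rw [Set.mem_ofPred_eq, hxq] at hx
  refine ⟨q, ⟨hq, ?_⟩, hx⟩
  have := dist_triangle q x 0
  have := h1.trans (min_le_right _ _)
  rw [Metric.mem_closedBall] at hxR ⊢
  rw [dist_comm] at hx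
  linarith

/-- Moving a boundary point along the axis `e` puts it strictly above the graph. This supplies the
fixed ball on which the `L²` norms are bounded below. -/
theorem IsLipschitzSet.interior_nonempty {Ω : Set (EuclideanSpace ℝ (Fin n))}
    (hΩ : IsLipschitzSet Ω) (hne : (frontier Ω).Nonempty) : (interior Ω).Nonempty := by
  obtain ⟨p, hp⟩ := hne
  obtain ⟨e, he, g, K, hg, U, hU, hgr⟩ := hΩ p hp
  have hp0 := graphHeight_eq_zero_of_mem_frontier hg hU hgr hp
  obtain ⟨r, hr, hrU⟩ := Metric.mem_nhds_iff.1 hU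
  refine ⟨p + (r / 2) • e, mem_interior.2 ⟨Metric.ball p r ∩ {x | 0 < graphHeight e g x}, ?_,
    Metric.isOpen_ball.inter (isOpen_lt continuous_const (continuous_graphHeight e hg)), ?_, ?_⟩⟩
  · exact fun x hx => (hgr x (hrU hx.1)).1 (sub_pos.1 hx.2)
  · rw [Metric.mem_ball, dist_self_add_left, norm_smul, he, mul_one, Real.norm_eq_abs,
      abs_of_pos (by linarith)]
    linarith
  · rw [Set.mem_ofPred_eq, graphHeight_add_smul he, hp0]; linarith

end RegionalPoincare

/-! ### Cutoff functions and their energy -/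

/-- The distance of an interior point to the boundary is at most its distance to the
complement. -/
theorem Metric.infDist_frontier_le_infDist_compl {E : Type*} [NormedAddCommGroup E]
    [NormedSpace ℝ E] {s : Set E} {x : E} (hx : x ∈ s) (hs : sᶜ.Nonempty) :
    Metric.infDist x (frontier s) ≤ Metric.infDist x sᶜ := by
  refine (Metric.le_infDist hs).2 fun y hy => ?_
  -- A segment from `s` to its complement that missed the frontier would be disconnected by the two
  -- interiors.
  obtain ⟨z, hz, hzf⟩ : (segment ℝ x y ∩ frontier s).Nonempty := by
    by_contra! hemp
    have hint : ∀ z ∈ segment ℝ x y, z ∈ interior s ∨ z ∈ interior sᶜ := fun z hz => by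
      by_contra! h
      rw [interior_compl, Set.mem_compl_iff, not_not] at h
      exact Set.notMem_empty z (hemp ▸ ⟨hz, h.2, h.1⟩)
    obtain ⟨z, -, hz1, hz2⟩ := (convex_segment (𝕜 := ℝ) x y).isPreconnected _ _
      isOpen_interior isOpen_interior hint
      ⟨x, left_mem_segment ℝ x y, (hint x (left_mem_segment ℝ x y)).resolve_right
        fun h => interior_subset h hx⟩
      ⟨y, right_mem_segment ℝ x y, (hint y (right_mem_segment ℝ x y)).resolve_left
        fun h => hy (interior_subset h)⟩
    exact interior_subset hz2 (interior_subset hz1)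
  have := dist_add_dist_of_mem_segment hz
  have := dist_nonneg (x := z) (y := y)
  exact (Metric.infDist_le_dist_of_mem hzf).trans (by linarith)

namespace RegionalPoincare

variable {n : ℕ}

/-- The test function is `ψ η = ψ - v` with `v = ψ (1 - η)`, where `ψ` cuts off at infinity and `η`
near the complement. The splitting charges the unbounded tail with Lipschitz constant `1` only; the
steep part `v` vanishes on `Ω` off a bounded tube. -/
theorem exists_isTestFunction_gagliardoIntegral_le {s σ R δ : ℝ} (hσ0 : 0 ≤ σ) (hσ1 : σ ≤ 1)
    (hδ0 : 0 < δ) (hδ1 : δ ≤ 1) {Ω : Set (EuclideanSpace ℝ (Fin n))} (hΩ : NullMeasurableSet Ω)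
    (hc : Ωᶜ.Nonempty) :
    ∃ φ : EuclideanSpace ℝ (Fin n) → ℝ, IsTestFunction Ω φ ∧
      (∀ x, ‖x‖ ≤ R → 4 * δ ≤ Metric.infDist x Ωᶜ → φ x = 1) ∧
      gagliardoIntegral s Ω φ ≤
        2 * (∫⁻ z : EuclideanSpace ℝ (Fin n), ENNReal.ofReal (truncKernel s σ z)) *
          (2 * volume.restrict Ω {x | R < ‖x‖} + ENNReal.ofReal (2 * (2 / δ) ^ (2 * σ)) *
            volume (Metric.closedBall 0 (R + 3) ∩
              {x | Metric.infDist x (frontier Ω) ≤ 4 * δ})) := by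
  let δ' : ℝ≥0 := ⟨δ, hδ0.le⟩
  -- The profile drops from `1` to `0` between radii `R + 1` and `R + 2`; mollifying at radius `1`
  -- widens this to `R` and `R + 3`.
  have hf1 : LipschitzWith 1 fun x : EuclideanSpace ℝ (Fin n) => max 0 (min 1 (R + 2 - ‖x‖)) := by
    refine LipschitzWith.const_max (LipschitzWith.const_min ?_ 1) 0
    refine LipschitzWith.of_dist_le_mul fun x y => ?_
    rw [Real.dist_eq, NNReal.coe_one, one_mul, dist_comm, dist_eq_norm]
    refine le_trans (le_of_eq ?_) (abs_norm_sub_norm_le y x)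
    congr 1; ring
  -- The ramp rises between distances `2δ` and `3δ`; mollifying at radius `δ` leaves `0` below `δ`
  -- and `1` from `4δ` on.
  have hf2 : LipschitzWith δ'⁻¹ fun x : EuclideanSpace ℝ (Fin n) =>
      max 0 (min 1 (Metric.infDist x Ωᶜ / δ - 2)) := by
    refine LipschitzWith.const_max (LipschitzWith.const_min ?_ 1) 0
    refine LipschitzWith.of_dist_le_mul fun x y => ?_
    have h := (Metric.lipschitz_infDist_pt (Ωᶜ)).dist_le_mul x y
    rw [NNReal.coe_one, one_mul, Real.dist_eq] at h
    rw [Real.dist_eq, NNReal.coe_inv, sub_sub_sub_cancel_right, ← sub_div, abs_div,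
      abs_of_pos hδ0, div_eq_inv_mul]
    exact mul_le_mul_of_nonneg_left h (inv_nonneg.2 hδ0.le)
  obtain ⟨ψ, hψs, hψ0, hψ1, hψL, hψ⟩ := hf1.exists_contDiff_mollification
    (fun x => le_max_left _ _) (fun x => max_le zero_le_one (min_le_left _ _)) one_pos
  obtain ⟨η, hηs, hη0, hη1, hηL, hη⟩ := hf2.exists_contDiff_mollification
    (fun x => le_max_left _ _) (fun x => max_le zero_le_one (min_le_left _ _)) hδ0
  have hψone : ∀ x, ‖x‖ ≤ R → ψ x = 1 := fun x hx => hψ x 1 fun y hy => by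
    have h := abs_norm_sub_norm_le y x
    rw [← dist_eq_norm] at h
    have := (abs_le.1 (h.trans (Metric.mem_ball.1 hy).le)).2
    rw [min_eq_left (by linarith), max_eq_right zero_le_one]
  have hψzero : ∀ x, R + 3 < ‖x‖ → ψ x = 0 := fun x hx => hψ x 0 fun y hy => by
    have h := abs_norm_sub_norm_le y x
    rw [← dist_eq_norm] at h
    have := (abs_le.1 (h.trans (Metric.mem_ball.1 hy).le)).1
    exact max_eq_left ((min_le_right _ _).trans (by linarith))
  have hηone : ∀ x, 4 * δ ≤ Metric.infDist x Ωᶜ → η x = 1 := fun x hx => hη x 1 fun y hy => by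
    have h := Metric.infDist_le_infDist_add_dist (s := Ωᶜ) (x := x) (y := y)
    rw [dist_comm] at h
    have h' := Metric.mem_ball.1 hy
    have : 3 ≤ Metric.infDist y Ωᶜ / δ := by rw [le_div_iff₀ hδ0]; linarith
    rw [min_eq_left (by linarith), max_eq_right zero_le_one]
  have hηzero : ∀ x, Metric.infDist x Ωᶜ < δ → η x = 0 := fun x hx => hη x 0 fun y hy => by
    have h := Metric.infDist_le_infDist_add_dist (s := Ωᶜ) (x := y) (y := x)
    have h' := Metric.mem_ball.1 hy
    have : Metric.infDist y Ωᶜ / δ ≤ 2 := by rw [div_le_iff₀ hδ0]; linarith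
    exact max_eq_left ((min_le_right _ _).trans (by linarith))
  -- One `1/δ` comes from `η`, the other absorbs the Lipschitz constant `1 ≤ 1/δ` of `ψ`.
  set L : ℝ := 2 / δ
  have hL : 1 ≤ L := by rw [one_le_div hδ0]; linarith
  set N : Set (EuclideanSpace ℝ (Fin n)) :=
    Metric.closedBall 0 (R + 3) ∩ {x | Metric.infDist x (frontier Ω) ≤ 4 * δ}
  have hN : MeasurableSet N := measurableSet_closedBall.inter
    (isClosed_le (Metric.continuous_infDist_pt _) continuous_const).measurableSet
  have hM : MeasurableSet {x : EuclideanSpace ℝ (Fin n) | R < ‖x‖} :=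
    (isOpen_lt continuous_const continuous_norm).measurableSet
  let v : EuclideanSpace ℝ (Fin n) → ℝ := fun x => ψ x * (1 - η x)
  have hv0 : ∀ x, 0 ≤ v x := fun x => mul_nonneg (hψ0 x) (sub_nonneg.2 (hη1 x))
  have hv1 : ∀ x, v x ≤ 1 := fun x =>
    mul_le_one₀ (hψ1 x) (sub_nonneg.2 (hη1 x)) (by linarith [hη0 x])
  have hψd : ∀ x y, |ψ x - ψ y| ≤ ‖x - y‖ := fun x y => by
    simpa [Real.dist_eq, dist_eq_norm] using hψL.dist_le_mul x y
  have hηd : ∀ x y, |η x - η y| ≤ δ⁻¹ * ‖x - y‖ := fun x y => by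
    have := hηL.dist_le_mul x y
    rwa [Real.dist_eq, dist_eq_norm, NNReal.coe_inv] at this
  have hψosc : ∀ x y, |ψ x - ψ y| ≤ 1 := fun x y => by
    rw [abs_le]; constructor <;> linarith [hψ0 x, hψ1 x, hψ0 y, hψ1 y]
  have hvosc : ∀ x y, |v x - v y| ≤ 1 := fun x y => by
    rw [abs_le]; constructor <;> linarith [hv0 x, hv1 x, hv0 y, hv1 y]
  have hvd : ∀ x y, |v x - v y| ≤ L * ‖x - y‖ := fun x y => by
    have h1 : v x - v y = (ψ x - ψ y) * (1 - η x) + ψ y * (η y - η x) := by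
      simp only [v]; ring
    have h2 : |(ψ x - ψ y) * (1 - η x)| ≤ ‖x - y‖ := by
      rw [abs_mul, abs_of_nonneg (sub_nonneg.2 (hη1 x))]
      exact (mul_le_of_le_one_right (abs_nonneg _) (by linarith [hη0 x])).trans (hψd x y)
    have h3 : |ψ y * (η y - η x)| ≤ δ⁻¹ * ‖x - y‖ := by
      rw [abs_mul, abs_of_nonneg (hψ0 y), abs_sub_comm]
      exact (mul_le_of_le_one_left (abs_nonneg _) (hψ1 y)).trans (hηd x y)
    have h4 : ‖x - y‖ ≤ δ⁻¹ * ‖x - y‖ :=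
      le_mul_of_one_le_left (norm_nonneg _) ((one_le_inv₀ hδ0).2 hδ1)
    rw [h1]
    refine (abs_add_le _ _).trans ((add_le_add (h2.trans h4) h3).trans (le_of_eq ?_))
    simp only [L]; ring
  have hvN : ∀ x ∈ Ω, x ∉ N → v x = 0 := fun x hx hxN => by
    by_cases hR : R + 3 < ‖x‖
    · simp [v, hψzero x hR]
    · have h1 : 4 * δ < Metric.infDist x (frontier Ω) := by
        by_contra! h
        exact hxN ⟨mem_closedBall_zero_iff.2 (not_lt.1 hR), h⟩
      have h2 := h1.le.trans (Metric.infDist_frontier_le_infDist_compl hx hc)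
      simp [v, hηone x h2]
  refine ⟨fun x => ψ x * η x, ⟨hψs.mul hηs, ?_⟩, fun x hxR hx => ?_, ?_⟩
  -- The support keeps distance `δ` from `Ωᶜ`, so its closure lies in `Ω` even when `Ω` is not open.
  · have hcl : IsClosed {x : EuclideanSpace ℝ (Fin n) | δ ≤ Metric.infDist x Ωᶜ} :=
      isClosed_le continuous_const (Metric.continuous_infDist_pt _)
    have hcomp := (isCompact_closedBall (0 : EuclideanSpace ℝ (Fin n)) (R + 3)).inter_right hcl
    have hsupp : Function.support (fun x => ψ x * η x) ⊆
        Metric.closedBall 0 (R + 3) ∩ {x | δ ≤ Metric.infDist x Ωᶜ} := fun x hx => by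
      refine ⟨?_, ?_⟩
      · by_contra h
        exact hx (by simp [hψzero x (not_le.1 fun h' => h (mem_closedBall_zero_iff.2 h'))])
      · by_contra h
        exact hx (by simp [hηzero x (not_le.1 h)])
    refine ⟨HasCompactSupport.of_support_subset_isCompact hcomp hsupp, fun x hx => ?_⟩
    have h1 : δ ≤ Metric.infDist x Ωᶜ := (closure_minimal hsupp hcomp.isClosed hx).2
    by_contra hxΩ
    rw [Metric.infDist_zero_of_mem (s := Ωᶜ) hxΩ] at h1
    linarith
  · change ψ x * η x = 1
    rw [hψone x hxR, hηone x hx, one_mul]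
  -- The factors `2` come from `(a - b)² ≤ 2a² + 2b²`; the base `1` is the Lipschitz constant of
  -- `ψ`.
  · let w : EuclideanSpace ℝ (Fin n) → ℝ := fun x =>
      {x | R < ‖x‖}.indicator (fun _ => 2 * (1 : ℝ) ^ (2 * σ)) x +
        N.indicator (fun _ => 2 * L ^ (2 * σ)) x
    have hL0 : 0 ≤ L ^ (2 * σ) := by positivity
    have hi1 : ∀ x, 0 ≤ {x : EuclideanSpace ℝ (Fin n) | R < ‖x‖}.indicator
        (fun _ => 2 * (1 : ℝ) ^ (2 * σ)) x :=
      fun x => Set.indicator_nonneg (fun _ _ => by positivity) x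
    have hi2 : ∀ x, 0 ≤ N.indicator (fun _ => 2 * L ^ (2 * σ)) x :=
      fun x => Set.indicator_nonneg (fun _ _ => by positivity) x
    have hm1 : Measurable ({x : EuclideanSpace ℝ (Fin n) | R < ‖x‖}.indicator
        (fun _ => 2 * (1 : ℝ) ^ (2 * σ))) := measurable_const.indicator hM
    have hm2 : Measurable (N.indicator (fun _ => 2 * L ^ (2 * σ))) := measurable_const.indicator hN
    have hind : ∀ (A : Set (EuclideanSpace ℝ (Fin n))) (c : ℝ), MeasurableSet A →
        ∫⁻ x in Ω, ENNReal.ofReal (A.indicator (fun _ => c) x) =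
          ENNReal.ofReal c * volume.restrict Ω A := fun A c hA => by
      rw [← lintegral_indicator_const hA]
      refine lintegral_congr fun x => ?_
      by_cases hx : x ∈ A <;> simp [hx]
    refine (gagliardoIntegral_le_of_quotient_le hΩ (w := w) (σ := σ) (hm1.add hm2)
      (fun x => add_nonneg (hi1 x) (hi2 x)) fun x hx y hy => ?_).trans ?_
    · have q1 := gagliardo_quotient_le (s := s) hσ0 hσ1 le_rfl (N := {x | R < ‖x‖}) (c := 1)
        (v := ψ) (fun x _ hxN => hψone x (not_lt.1 hxN)) hψosc (fun x y => by
          rw [one_mul]; exact hψd x y) hx hy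
      have q2 := gagliardo_quotient_le (s := s) hσ0 hσ1 hL hvN hvosc hvd hx hy
      have h1 : ψ x * η x - ψ y * η y = (ψ x - ψ y) - (v x - v y) := by simp only [v]; ring
      have h2 : |ψ x * η x - ψ y * η y| ^ 2 ≤ 2 * |ψ x - ψ y| ^ 2 + 2 * |v x - v y| ^ 2 := by
        rw [h1, sq_abs, sq_abs, sq_abs]
        nlinarith [sq_nonneg ((ψ x - ψ y) + (v x - v y))]
      have h3 := div_le_div_of_nonneg_right h2
        (Real.rpow_nonneg (norm_nonneg (x - y)) ((n : ℝ) + 2 * s))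
      refine h3.trans ?_
      rw [add_div, mul_div_assoc, mul_div_assoc]
      refine (add_le_add (mul_le_mul_of_nonneg_left q1 zero_le_two)
        (mul_le_mul_of_nonneg_left q2 zero_le_two)).trans (le_of_eq ?_)
      have hdbl : ∀ (A : Set (EuclideanSpace ℝ (Fin n))) (c : ℝ) (z : EuclideanSpace ℝ (Fin n)),
          A.indicator (fun _ => 2 * c) z = 2 * A.indicator (fun _ => c) z :=
        fun A c z => by by_cases hz : z ∈ A <;> simp [hz]
      simp only [w, hdbl]
      ring
    · refine mul_le_mul' le_rfl ?_
      simp only [w]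
      rw [lintegral_congr fun x => ENNReal.ofReal_add (hi1 x) (hi2 x),
        lintegral_add_left hm1.ennreal_ofReal, hind _ _ hM, hind _ _ hN]
      refine add_le_add (by simp) (mul_le_mul' le_rfl (Measure.restrict_apply_le _ _))

/-! ### Choice of the scales and conclusion -/

theorem IsTestFunction.memWZero {s : ℝ} {Ω : Set (EuclideanSpace ℝ (Fin n))}
    {φ : EuclideanSpace ℝ (Fin n) → ℝ} (hφ : IsTestFunction Ω φ)
    (hg : gagliardoIntegral s Ω φ < ⊤) : MemWZero s Ω φ := by
  refine ⟨⟨(hφ.1.continuous.memLp_of_hasCompactSupport hφ.2.1).restrict Ω, hg⟩,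
    fun ε hε => ⟨φ, hφ, ?_⟩⟩
  simpa [sobolevNorm, l2Sq, gagliardoSq, gagliardoIntegral] using hε

/-- The product is a constant times `δ^(1-2σ)`, and `σ < 1/2` makes the exponent positive. -/
theorem tendsto_tube_bound {σ : ℝ} (hσ : σ < 1 / 2) {C : ℝ≥0∞} (hC : C ≠ ⊤) :
    Tendsto (fun δ : ℝ => ENNReal.ofReal (2 * (2 / δ) ^ (2 * σ)) * (ENNReal.ofReal (4 * δ) * C))
      (𝓝[>] 0) (𝓝 0) := by
  have h1 : Tendsto (fun δ : ℝ => 8 * 2 ^ (2 * σ) * δ ^ (1 - 2 * σ)) (𝓝[>] 0) (𝓝 0) := by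
    have h : ContinuousAt (fun δ : ℝ => 8 * 2 ^ (2 * σ) * δ ^ (1 - 2 * σ)) 0 :=
      (Real.continuousAt_rpow_const _ _ (Or.inr (by linarith))).const_mul _
    have h2 := h.tendsto
    rw [Real.zero_rpow (by linarith), mul_zero] at h2
    exact h2.mono_left nhdsWithin_le_nhds
  have h2 := ENNReal.Tendsto.mul_const (b := C) (ENNReal.tendsto_ofReal h1) (Or.inr hC)
  rw [ENNReal.ofReal_zero, zero_mul] at h2
  refine h2.congr' ?_
  filter_upwards [self_mem_nhdsWithin] with δ hδ
  have hδ : 0 < δ := hδ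
  rw [← mul_assoc, ← ENNReal.ofReal_mul (by positivity)]
  congr 2
  rw [Real.div_rpow zero_le_two hδ.le, Real.rpow_sub hδ, Real.rpow_one]
  ring

/-- A Lipschitz set of finite measure carries test functions of arbitrarily small Gagliardo
energy that equal `1` on a fixed ball. -/
theorem exists_isTestFunction_small_energy [NeZero n] {s : ℝ} (hs0 : 0 < s) (hs1 : s < 1 / 2)
    {Ω : Set (EuclideanSpace ℝ (Fin n))} (hne : Ω.Nonempty) (hmeas : NullMeasurableSet Ω)
    (hLip : IsLipschitzSet Ω) (hfin : volume Ω < ⊤) :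
    ∃ m : ℝ≥0∞, m ≠ 0 ∧ ∀ ε : ℝ≥0∞, 0 < ε → ∃ φ : EuclideanSpace ℝ (Fin n) → ℝ,
      IsTestFunction Ω φ ∧ gagliardoIntegral s Ω φ ≤ ε ∧ m ≤ l2Sq Ω φ := by
  -- A nontrivial Euclidean space is not compact, so its Haar measure is infinite. Finite measure
  -- thus forces `Ω` to have a complement and a boundary.
  have hnt : Nontrivial (EuclideanSpace ℝ (Fin n)) := inferInstance
  have huniv : Ω ≠ Set.univ := by
    rintro rfl
    exact hfin.ne (measure_univ_of_isAddLeftInvariant _)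
  have hc : Ωᶜ.Nonempty := Set.nonempty_compl.2 huniv
  have hfr : (frontier Ω).Nonempty := nonempty_frontier_iff.2 ⟨hne, huniv⟩
  obtain ⟨x₀, hx₀⟩ := hLip.interior_nonempty hfr
  obtain ⟨r, hr, hrΩ⟩ := Metric.mem_nhds_iff.1 (mem_interior_iff_mem_nhds.1 hx₀)
  -- The midpoint of `s` and `1/2`: above `s` for integrability of the kernel, below `1/2` for the
  -- tube bound.
  set σ : ℝ := 1 / 4 + s / 2 with hσ
  set A := ∫⁻ z : EuclideanSpace ℝ (Fin n), ENNReal.ofReal (truncKernel s σ z)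
  have hA : A ≠ ⊤ :=
    ((integrable_truncKernel (n := n) hs0 (σ := σ) (by linarith)).lintegral_lt_top).ne
  have hA2 : 2 * A ≠ ⊤ := ENNReal.mul_ne_top ENNReal.ofNat_ne_top hA
  refine ⟨volume (Metric.ball x₀ (r / 2)), (Metric.measure_ball_pos _ _ (by linarith)).ne',
    fun ε hε => ?_⟩
  have hε2 : 0 < ε / 2 := ENNReal.half_pos hε.ne'
  have htail : Tendsto (fun k : ℕ => 2 * A * (2 * volume.restrict Ω {x | (k : ℝ) < ‖x‖}))
      atTop (𝓝 0) := by
    have hf : IsFiniteMeasure (volume.restrict Ω) := ⟨by simpa using hfin⟩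
    have h := tendsto_measure_iInter_atTop (μ := volume.restrict Ω)
      (s := fun k : ℕ => {x : EuclideanSpace ℝ (Fin n) | (k : ℝ) < ‖x‖})
      (fun k => (isOpen_lt continuous_const continuous_norm).measurableSet.nullMeasurableSet)
      (fun i j hij x (hx : (j : ℝ) < ‖x‖) =>
        show (i : ℝ) < ‖x‖ from lt_of_le_of_lt (Nat.cast_le.2 hij) hx) ⟨0, measure_ne_top _ _⟩
    have hemp : ⋂ k : ℕ, {x : EuclideanSpace ℝ (Fin n) | (k : ℝ) < ‖x‖} = ∅ := by
      refine Set.eq_empty_of_forall_notMem fun x hx => ?_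
      obtain ⟨k, hk⟩ := exists_nat_ge ‖x‖
      exact absurd (Set.mem_iInter.1 hx k) (not_lt.2 hk)
    rw [hemp, measure_empty] at h
    have h2 := ENNReal.Tendsto.const_mul (a := 2 * A) (ENNReal.Tendsto.const_mul (a := 2) h
      (Or.inr ENNReal.ofNat_ne_top)) (Or.inr hA2)
    simpa using h2
  obtain ⟨k, hk, hkR⟩ := ((htail.eventually (gt_mem_nhds hε2)).and
    (eventually_ge_atTop ⌈‖x₀‖ + r⌉₊)).exists
  have hkR : ‖x₀‖ + r ≤ k := Nat.ceil_le.1 hkR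
  -- The tube constant depends on the radius, so `k` is fixed before `δ`.
  obtain ⟨C, hC, t₀, ht₀, htube⟩ := hLip.exists_volume_tube_le hfr (k + 3)
  have hstrip := ENNReal.Tendsto.const_mul (a := 2 * A)
    (tendsto_tube_bound (σ := σ) (by linarith) hC.ne) (Or.inr hA2)
  rw [mul_zero] at hstrip
  -- The tube has width `4δ`, hence `t₀ / 4`; and `δ < r / 8` gives `4δ < r / 2`, so `φ = 1` on the
  -- half ball.
  have hδpos : 0 < min (min 1 (t₀ / 4)) (r / 8) := by positivity
  obtain ⟨δ, hδ, hδ0, hδ1⟩ := ((hstrip.eventually (gt_mem_nhds hε2)).and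
    (Ioo_mem_nhdsGT hδpos)).exists
  rw [lt_min_iff, lt_min_iff] at hδ1
  obtain ⟨⟨hδ1, hδt⟩, hδr⟩ := hδ1
  obtain ⟨φ, hφ, hφ1, hφg⟩ := exists_isTestFunction_gagliardoIntegral_le (s := s) (σ := σ)
    (R := k) (by linarith) (by linarith) hδ0 hδ1.le hmeas hc
  refine ⟨φ, hφ, hφg.trans ?_, ?_⟩
  · rw [mul_add, ← ENNReal.add_halves ε]
    refine add_le_add hk.le (le_trans ?_ hδ.le)
    exact mul_le_mul' le_rfl (mul_le_mul' le_rfl (htube (4 * δ) (by linarith) (by linarith)))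
  · have hsub : Metric.ball x₀ (r / 2) ⊆ Ω := (Metric.ball_subset_ball (by linarith)).trans hrΩ
    calc volume (Metric.ball x₀ (r / 2))
        = ∫⁻ x in Metric.ball x₀ (r / 2), ENNReal.ofReal (φ x ^ 2) := by
          rw [← setLIntegral_one]
          refine setLIntegral_congr_fun measurableSet_ball fun x hx => ?_
          have hxd := Metric.mem_ball.1 hx
          have h1 : φ x = 1 := by
            refine hφ1 x ?_ ((Metric.le_infDist hc).2 fun y hy => ?_)
            · have := norm_sub_norm_le x x₀
              rw [← dist_eq_norm] at this
              linarith
            · have hy : r ≤ dist y x₀ := not_lt.1 fun h => hy (hrΩ h)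
              have := dist_triangle y x x₀
              rw [dist_comm y x] at this
              linarith
          simp [h1]
      _ ≤ l2Sq Ω φ := lintegral_mono_set hsub

end RegionalPoincare

theorem mainTheorem5 {n : ℕ} [NeZero n] (s : ℝ) (hs0 : 0 < s) (hs1 : s < 1 / 2)
    (Ω : Set (EuclideanSpace ℝ (Fin n))) (hne : Ω.Nonempty)
    (hmeas : NullMeasurableSet Ω) (hLip : RegionalPoincare.IsLipschitzSet Ω)
    (hfin : volume Ω < ⊤)
    (hdecay : RegionalPoincare.DecayInOneDirection Ω)
    (hbdd : ∀ K : ℝ, 0 < K → Bornology.IsBounded (Ω ∩ {x | |x 0| < K})) :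
    RegionalPoincare.regionalPoincareConst s Ω = 0 := by
  obtain ⟨m, hm, h⟩ :=
    RegionalPoincare.exists_isTestFunction_small_energy hs0 hs1 hne hmeas hLip hfin
  set c := ENNReal.ofReal (RegionalPoincare.fracConst n s / 2)
  have hbound : ∀ k : ℕ, RegionalPoincare.regionalPoincareConst s Ω ≤ c / m * (k : ℝ≥0∞)⁻¹ := by
    intro k
    -- The minimum with `1` keeps `ε` finite at `k = 0`, where the inverse is `∞`; finiteness puts
    -- `φ` in the Sobolev space.
    obtain ⟨ε, hε, hεk⟩ : ∃ ε : ℝ≥0∞, 0 < ε ∧ ε < ⊤ ∧ ε ≤ (k : ℝ≥0∞)⁻¹ :=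
      ⟨min 1 (k : ℝ≥0∞)⁻¹, lt_min one_pos (ENNReal.inv_pos.2 (ENNReal.natCast_ne_top k)),
        (min_le_left _ _).trans_lt ENNReal.one_lt_top, min_le_right _ _⟩
    obtain ⟨φ, hφ, hg, hl⟩ := h ε hε
    have hφ0 : ¬ φ =ᵐ[volume.restrict Ω] 0 := fun h0 => by
      have : RegionalPoincare.l2Sq Ω φ = 0 := by
        unfold RegionalPoincare.l2Sq
        rw [lintegral_congr_ae (g := fun _ => 0) (h0.mono fun x hx => by simp [hx])]
        simp
      exact hm (le_zero_iff.1 (hl.trans_eq this))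
    refine (iInf₂_le_of_le φ (hφ.memWZero (hg.trans_lt hεk.1)) (iInf_le _ hφ0)).trans ?_
    calc RegionalPoincare.gagliardoSq s Ω φ / RegionalPoincare.l2Sq Ω φ
        ≤ c * (k : ℝ≥0∞)⁻¹ / m :=
          ENNReal.div_le_div (mul_le_mul' le_rfl (hg.trans hεk.2)) hl
      _ = c / m * (k : ℝ≥0∞)⁻¹ := by
          rw [div_eq_mul_inv, div_eq_mul_inv, mul_right_comm]
  have hlim := ENNReal.Tendsto.const_mul (a := c / m) ENNReal.tendsto_inv_nat_nhds_zero
    (Or.inr (ENNReal.div_ne_top ENNReal.ofReal_ne_top hm))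
  rw [mul_zero] at hlim
  exact le_zero_iff.1 (ge_of_tendsto' hlim hbound)
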